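/- For a set $K\subset\mathbb R^d$, a point $x\in K$ and a scale $r>0$, let the convex density of $K$ at $x$ at scale $r$ be $$d_K(x,r)=\frac{\operatorname{diam}\bigl(\operatorname{conv}(K\cap B(x,r))\bigr)}{2r},$$ where $B(x,r)$ is the Euclidean ball and $\operatorname{conv}$ denotes the convex hull. Theorem. Let $d\ge 1$. There is a constant $c>0$, depending only on the dimension $d$ of the ambient space, with the following property. Let $N\subset\mathbb R^d$ be any set and let $d_0\in\mathbb R$. Suppose that for every $x\in N$ $$\liminf_{r\to 0^+}\frac{\int_r^1 d_N^2(x,t)\,\frac{dt}{t}}{-\log r}\le d_0^2 .$$ Then the Hausdorff dimension of $N$ satisfies $$\dim_H N\le c\,d_0^2 .$$ -/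

import Mathlib

open Filter Topology

/-- The convex density of a set `K ⊆ ℝ^d` at the point `x` and the scale `r > 0`:
the diameter of the convex hull of `K ∩ B(x, r)`, divided by `2 r`.
For `r > 0` it lies in `[0, 1]`, because `K ∩ B(x, r)` is contained in a ball of diameter `2 r`. -/
noncomputable def convexDensity {d : ℕ} (K : Set (EuclideanSpace ℝ (Fin d)))
    (x : EuclideanSpace ℝ (Fin d)) (r : ℝ) : ℝ :=
  Metric.diam (convexHull ℝ (K ∩ Metric.ball x r)) / (2 * r)

/-- The lower logarithmic mean over all scales of the squared convex density,
`liminf_{r → 0+} (∫_r^1 d_K(x,t)^2 dt/t) / (- log r)`.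
For `0 < r < 1` the integrand is measurable and lies between `0` and `1 / t`, so that the quotient
lies in `[0, 1]`; the integral and the real-valued `liminf` therefore have their usual meaning. -/
noncomputable def lowerMeanConvexDensitySq {d : ℕ} (K : Set (EuclideanSpace ℝ (Fin d)))
    (x : EuclideanSpace ℝ (Fin d)) : ℝ :=
  liminf (fun r : ℝ => (∫ t in r..1, (convexDensity K x t) ^ 2 / t) / (-Real.log r)) (𝓝[>] 0)

/-! Each branching scale of `N` at `x` contributes a fixed amount to the integral of the squared
density, so a small mean leaves few of them (`branchingCount_le_integral`). A piece of `N` has to be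
subdivided only at scales that branch at all of its points, so `m` branching scales cost at most `M
^ m` pieces (`exists_cover_of_branchingCount_le`). The liminf bounds the count only along a sequence
of scales depending on the point; a Borel–Cantelli type sum handles this
(`dimH_le_of_frequently_cover`). -/

/-- The set `N` has a point at distance comparable to `2 ^ (-k)` from `x`. -/
def IsBranchingScale {X : Type*} [PseudoMetricSpace X] (N : Set X) (x : X) (k : ℕ) : Prop :=
  ∃ y ∈ N, (1 / 2 : ℝ) ^ (k + 3) ≤ dist x y ∧ dist x y < (1 / 2 : ℝ) ^ (k + 1)

open Classical in
/-- The number of branching scales `k` of `N` at `x` with `a ≤ k < b`. -/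
noncomputable def branchingCount {X : Type*} [PseudoMetricSpace X] (N : Set X) (x : X)
    (a b : ℕ) : ℕ :=
  ((Finset.Ico a b).filter (IsBranchingScale N x)).card

theorem branchingCount_eq_of_not {X : Type*} [PseudoMetricSpace X] {N : Set X} {x : X} {a b : ℕ}
    (hab : a < b) (h : ¬ IsBranchingScale N x a) :
    branchingCount N x a b = branchingCount N x (a + 1) b := by
  classical
  unfold branchingCount
  rw [← Finset.insert_Ico_add_one_left_eq_Ico hab, Finset.filter_insert, if_neg h]

theorem branchingCount_eq_of {X : Type*} [PseudoMetricSpace X] {N : Set X} {x : X} {a b : ℕ}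
    (hab : a < b) (h : IsBranchingScale N x a) :
    branchingCount N x a b = branchingCount N x (a + 1) b + 1 := by
  classical
  unfold branchingCount
  rw [← Finset.insert_Ico_add_one_left_eq_Ico hab, Finset.filter_insert, if_pos h,
    Finset.card_insert_of_notMem (by simp)]

theorem branchingCount_succ_le {X : Type*} [PseudoMetricSpace X] (N : Set X) (x : X) {a b : ℕ}
    (hab : a < b) : branchingCount N x (a + 1) b ≤ branchingCount N x a b := by
  by_cases h : IsBranchingScale N x a
  · rw [branchingCount_eq_of hab h]; omega
  · rw [branchingCount_eq_of_not hab h]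

/-- Every set of diameter less than `r` is covered by at most `M` of its subsets of diameter less
than `r / 2`. -/
def IsHalvingConstant (X : Type*) [PseudoMetricSpace X] (M : ℕ) : Prop :=
  ∀ (r : ℝ) (E : Set X), 0 < r → (∀ x ∈ E, ∀ y ∈ E, dist x y < r) →
    ∃ F : Finset (Set X), F.card ≤ M ∧ E ⊆ ⋃ U ∈ F, U ∧
      ∀ U ∈ F, U ⊆ E ∧ ∀ x ∈ U, ∀ y ∈ U, dist x y < r / 2

/-- One finite 1/5-net of the unit ball serves every set after translation and scaling: its balls
acquire diameter at most `2 * r / 5 < r / 2`. -/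
theorem exists_isHalvingConstant (V : Type*) [NormedAddCommGroup V] [NormedSpace ℝ V]
    [ProperSpace V] : ∃ M, IsHalvingConstant V M := by
  classical
  obtain ⟨t, -, ht, hcov⟩ := Metric.finite_approx_of_totallyBounded
    (isCompact_closedBall (0 : V) 1).totallyBounded (1 / 5) (by norm_num)
  refine ⟨ht.toFinset.card, fun r E hr hE => ?_⟩
  rcases E.eq_empty_or_nonempty with rfl | ⟨x₀, hx₀⟩
  · exact ⟨∅, by simp, by simp, by simp⟩
  refine ⟨ht.toFinset.image fun c => Metric.ball (x₀ + r • c) (r / 5) ∩ E,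
    Finset.card_image_le, fun x hx => ?_, fun U hU => ?_⟩
  · have hmem : r⁻¹ • (x - x₀) ∈ Metric.closedBall (0 : V) 1 := by
      rw [mem_closedBall_zero_iff, norm_smul, norm_inv, Real.norm_of_nonneg hr.le,
        ← dist_eq_norm, inv_mul_le_iff₀ hr, mul_one]
      exact (hE x hx x₀ hx₀).le
    obtain ⟨c, hc, hxc⟩ := Set.mem_iUnion₂.1 (hcov hmem)
    refine Set.mem_iUnion₂.2 ⟨_, Finset.mem_image_of_mem _ (ht.mem_toFinset.2 hc), ?_, hx⟩
    have h1 : x - (x₀ + r • c) = r • (r⁻¹ • (x - x₀) - c) := by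
      rw [smul_sub, smul_inv_smul₀ hr.ne']; abel
    rw [Metric.mem_ball, dist_eq_norm] at hxc ⊢
    rw [h1, norm_smul, Real.norm_of_nonneg hr.le]
    calc r * _ < r * (1 / 5) := by gcongr
      _ = r / 5 := by ring
  · obtain ⟨c, -, rfl⟩ := Finset.mem_image.1 hU
    refine ⟨Set.inter_subset_right, fun x hx y hy => ?_⟩
    have hx' := Metric.mem_ball.1 hx.1
    have hy' := Metric.mem_ball.1 hy.1
    have := dist_triangle_right x y (x₀ + r • c)
    linarith

theorem exists_cover_of_branchingCount_le {X : Type*} [PseudoMetricSpace X] {M : ℕ}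
    (hM1 : 1 ≤ M) (hM : IsHalvingConstant X M) (N : Set X) (p : ℕ) :
    ∀ (j m : ℕ) (E : Set X), E ⊆ N →
      (∀ x ∈ E, ∀ y ∈ E, dist x y < (1 / 2 : ℝ) ^ (j + 1)) →
      (∀ x ∈ E, branchingCount N x j (j + p) ≤ m) →
      ∃ F : Finset (Set X), F.card ≤ M ^ m ∧ E ⊆ ⋃ U ∈ F, U ∧
        ∀ U ∈ F, ∀ x ∈ U, ∀ y ∈ U, dist x y < (1 / 2 : ℝ) ^ (j + p + 1) := by
  classical
  induction p with
  | zero =>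
    intro j m E _ hE _
    exact ⟨{E}, by simpa using Nat.one_le_pow _ _ hM1, by simp, by simpa using hE⟩
  | succ p ih =>
    intro j m E hEN hE hm
    have hjp : j < j + (p + 1) := by omega
    have hadd : j + (p + 1) = j + 1 + p := by ring
    by_cases hsmall : ∀ x ∈ E, ∀ y ∈ E, dist x y < (1 / 2 : ℝ) ^ (j + 1 + 1)
    · rw [hadd] at hm hjp ⊢
      exact ih (j + 1) m E hEN hsmall
        fun x hx => (branchingCount_succ_le N x hjp).trans (hm x hx)
    push Not at hsmall
    obtain ⟨y, hy, z, hz, hyz⟩ := hsmall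
    -- The points `y` and `z` are too far apart to both lie within `(1/2)^(j+3)` of `x`; so
    -- splitting `E` uses up one branching scale at each of its points.
    have hbr : ∀ x ∈ E, IsBranchingScale N x j := by
      intro x hx
      have htri := dist_triangle_left y z x
      have hpow : (1 / 2 : ℝ) ^ (j + 1 + 1) = 2 * (1 / 2 : ℝ) ^ (j + 3) := by ring
      rcases le_or_gt ((1 / 2 : ℝ) ^ (j + 3)) (dist x y) with h | h
      · exact ⟨y, hEN hy, h, hE x hx y hy⟩
      · exact ⟨z, hEN hz, by linarith, hE x hx z hz⟩
    obtain ⟨m, rfl⟩ : ∃ m', m = m' + 1 := by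
      have := hm y hy
      rw [branchingCount_eq_of hjp (hbr y hy)] at this
      exact ⟨m - 1, by omega⟩
    obtain ⟨F, hFc, hFE, hF⟩ := hM _ E (by positivity) hE
    have hsub : ∀ U ∈ F, ∃ G : Finset (Set X), G.card ≤ M ^ m ∧ U ⊆ ⋃ W ∈ G, W ∧
        ∀ W ∈ G, ∀ x ∈ W, ∀ y ∈ W, dist x y < (1 / 2 : ℝ) ^ (j + (p + 1) + 1) := by
      intro U hU
      rw [hadd] at hm hjp ⊢
      refine ih (j + 1) m U ((hF U hU).1.trans hEN) (fun x hx y hy => ?_) fun x hx => ?_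
      · refine ((hF U hU).2 x hx y hy).trans_eq (by ring)
      · have hxE := (hF U hU).1 hx
        have := hm x hxE
        rw [branchingCount_eq_of hjp (hbr x hxE)] at this
        omega
    choose! G hGc hGU hG using hsub
    refine ⟨F.biUnion G, ?_, fun x hx => ?_, fun W hW => ?_⟩
    · calc (F.biUnion G).card ≤ F.card * M ^ m := Finset.card_biUnion_le_card_mul _ _ _ hGc
        _ ≤ M * M ^ m := by gcongr
        _ = M ^ (m + 1) := by ring
    · obtain ⟨U, hU, hxU⟩ := Set.mem_iUnion₂.1 (hFE hx)
      obtain ⟨W, hW, hxW⟩ := Set.mem_iUnion₂.1 (hGU U hU hxU)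
      exact Set.mem_iUnion₂.2 ⟨W, Finset.mem_biUnion.2 ⟨U, hU, hW⟩, hxW⟩
    · obtain ⟨U, hU, hWU⟩ := Finset.mem_biUnion.1 hW
      exact hG U hU W hWU

/-! ### Hausdorff dimension of limsup sets -/

open MeasureTheory ENNReal in
theorem dimH_le_of_frequently_cover {X : Type*} [MetricSpace X] {E : Set X} {b : ℝ} (hb : 0 ≤ b)
    (F : ℕ → Finset (Set X)) (hcard : ∀ n, ((F n).card : ℝ≥0∞) ≤ 2 ^ (b * n))
    (hdiam : ∀ n, ∀ U ∈ F n, ∀ x ∈ U, ∀ y ∈ U, dist x y ≤ (1 / 2 : ℝ) ^ n)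
    (hE : ∀ x ∈ E, ∃ᶠ n in atTop, ∃ U ∈ F n, x ∈ U) : dimH E ≤ ENNReal.ofReal b := by
  borelize X
  refine le_of_forall_gt_imp_ge_of_dense fun s hs => ?_
  rcases eq_or_ne s ∞ with rfl | hs'
  · exact le_top
  lift s to NNReal using hs'
  have hbs : b < s := by
    rw [ENNReal.ofReal_lt_iff_lt_toReal hb ENNReal.coe_ne_top] at hs
    simpa using hs
  refine dimH_le_of_hausdorffMeasure_ne_top ?_
  have hpow : ∀ n : ℕ, ENNReal.ofReal ((1 / 2 : ℝ) ^ n) = 2 ^ (-(n : ℝ)) := by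
    intro n
    rw [ENNReal.rpow_neg, ENNReal.rpow_natCast, ENNReal.ofReal_pow (by norm_num), one_div,
      ENNReal.ofReal_inv_of_pos (by norm_num), ENNReal.inv_pow]
    simp
  have hed : ∀ n, ∀ U ∈ F n, Metric.ediam U ≤ 2 ^ (-(n : ℝ)) := by
    intro n U hU
    rw [← hpow]
    refine Metric.ediam_le fun x hx y hy => ?_
    rw [edist_dist]
    exact ENNReal.ofReal_le_ofReal (hdiam n U hU x hx y hy)
  set q : ℝ≥0∞ := 2 ^ (b - s) with hq
  have hq1 : q < 1 := ENNReal.rpow_lt_one_of_one_lt_of_neg (by norm_num) (by linarith)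
  have hsum : ∀ n, ∑ U ∈ F n, Metric.ediam U ^ (s : ℝ) ≤ q ^ n := by
    intro n
    calc ∑ U ∈ F n, Metric.ediam U ^ (s : ℝ)
        ≤ ∑ U ∈ F n, (2 ^ (-(n : ℝ))) ^ (s : ℝ) :=
          Finset.sum_le_sum fun U hU => ENNReal.rpow_le_rpow (hed n U hU) s.2
      _ = (F n).card * 2 ^ (-(n : ℝ) * s) := by
          rw [Finset.sum_const, nsmul_eq_mul, ENNReal.rpow_mul]
      _ ≤ 2 ^ (b * n) * 2 ^ (-(n : ℝ) * s) := by gcongr; exact hcard n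
      _ = q ^ n := by
          rw [← ENNReal.rpow_add _ _ (by norm_num) (by norm_num), hq, ← ENNReal.rpow_natCast,
            ← ENNReal.rpow_mul]
          congr 1; ring
  -- All families of index at least `n` together cover `E`, and their sums are dominated by a
  -- geometric series.
  have hmeas := Measure.hausdorffMeasure_le_liminf_tsum (X := X) (ι := fun n : ℕ => Σ k : ℕ, F (n + k))
    (s : ℝ) E (l := atTop) (fun n => ENNReal.ofReal ((1 / 2 : ℝ) ^ n))
    (by
      have := ENNReal.tendsto_ofReal
        (tendsto_pow_atTop_nhds_zero_of_lt_one (r := (1 / 2 : ℝ)) (by norm_num) (by norm_num))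
      simpa using this)
    (fun n i => i.2.1)
    (Eventually.of_forall fun n i => by
      rw [hpow]
      refine (hed _ _ i.2.2).trans (ENNReal.rpow_le_rpow_of_exponent_le (by norm_num) ?_)
      simp)
    (Eventually.of_forall fun n x hx => by
      obtain ⟨k, hk, U, hU, hxU⟩ := (frequently_atTop.1 (hE x hx)) n
      obtain ⟨i, rfl⟩ := Nat.exists_eq_add_of_le hk
      exact Set.mem_iUnion.2 ⟨⟨i, ⟨U, hU⟩⟩, hxU⟩)
  refine ne_top_of_le_ne_top ?_ (hmeas.trans (liminf_le_of_le (a := (1 - q)⁻¹) ?_ ?_))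
  · exact ENNReal.inv_ne_top.2 (tsub_pos_of_lt hq1).ne'
  · isBoundedDefault
  · intro c hc
    obtain ⟨n, hn⟩ := hc.exists
    refine hn.trans ?_
    rw [ENNReal.tsum_sigma', ← ENNReal.tsum_geometric]
    refine ENNReal.tsum_le_tsum fun k => ?_
    rw [Finset.tsum_subtype (F (n + k)) fun U => Metric.ediam U ^ (s : ℝ)]
    exact (hsum _).trans (pow_le_pow_right_of_le_one' hq1.le (by omega))

open ENNReal in
theorem dimH_le_of_frequently_branchingCount_le {X : Type*} [MetricSpace X]
    [TopologicalSpace.SeparableSpace X] {D : ℕ} (hD : IsHalvingConstant X (2 ^ D)) {N : Set X}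
    {β : ℝ} (hβ : 0 ≤ β)
    (hN : ∀ x ∈ N, ∃ᶠ n : ℕ in atTop, (branchingCount N x 0 n : ℝ) ≤ β * n) :
    dimH N ≤ ENNReal.ofReal (D * β) := by
  rcases isEmpty_or_nonempty X with hX | hX
  · simp [Set.eq_empty_of_isEmpty N]
  -- Radius 1/4 gives pieces of diameter small enough to start the covering at scale 0; dimension is
  -- countably stable.
  have hcov : N ⊆ ⋃ i, N ∩ Metric.ball (TopologicalSpace.denseSeq X i) (1 / 4) := by
    intro x hx
    obtain ⟨i, hi⟩ := (TopologicalSpace.denseRange_denseSeq X).exists_dist_lt x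
      (show (0 : ℝ) < 1 / 4 by norm_num)
    exact Set.mem_iUnion.2 ⟨i, hx, hi⟩
  refine (dimH_mono hcov).trans ?_
  rw [dimH_iUnion]
  refine iSup_le fun i => ?_
  set E := N ∩ Metric.ball (TopologicalSpace.denseSeq X i) (1 / 4) with hE
  have hEd : ∀ x ∈ E, ∀ y ∈ E, dist x y < (1 / 2 : ℝ) ^ (0 + 1) := by
    intro x hx y hy
    have hx' := Metric.mem_ball.1 hx.2
    have hy' := Metric.mem_ball.1 hy.2
    have := dist_triangle_right x y (TopologicalSpace.denseSeq X i)
    norm_num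
    linarith
  have hF := fun n : ℕ => exists_cover_of_branchingCount_le Nat.one_le_two_pow hD N n 0 ⌊β * n⌋₊
    {x ∈ E | (branchingCount N x 0 n : ℝ) ≤ β * n} (fun x hx => hx.1.1)
    (fun x hx y hy => hEd x hx.1 y hy.1) (fun x hx => by
      rw [zero_add]; exact Nat.le_floor hx.2)
  choose F hFc hFE hFd using hF
  refine dimH_le_of_frequently_cover (by positivity) F (fun n => ?_) (fun n U hU x hx y hy => ?_)
    fun x hx => ?_
  · calc ((F n).card : ℝ≥0∞) ≤ (((2 ^ D) ^ ⌊β * n⌋₊ : ℕ) : ℝ≥0∞) := by exact_mod_cast hFc n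
      _ = 2 ^ ((D * ⌊β * n⌋₊ : ℕ) : ℝ) := by
          rw [ENNReal.rpow_natCast, pow_mul]; push_cast; rfl
      _ ≤ 2 ^ (D * β * n) := by
          refine ENNReal.rpow_le_rpow_of_exponent_le (by norm_num) ?_
          have := Nat.floor_le (show 0 ≤ β * n by positivity)
          push_cast
          rw [mul_assoc]
          gcongr
  · refine (hFd n U hU x hx y hy).le.trans ?_
    exact pow_le_pow_of_le_one (by norm_num) (by norm_num) (by omega)
  · refine (hN x hx.1).mono fun n hn => ?_
    obtain ⟨U, hU, hxU⟩ := Set.mem_iUnion₂.1 (hFE n ⟨hx, hn⟩)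
    exact ⟨U, hU, hxU⟩

/-! ### Convex density and branching scales -/

theorem convexDensity_eq {d : ℕ} (K : Set (EuclideanSpace ℝ (Fin d)))
    (x : EuclideanSpace ℝ (Fin d)) (r : ℝ) :
    convexDensity K x r = Metric.diam (K ∩ Metric.ball x r) / (2 * r) := by
  rw [convexDensity, convexHull_diam]

theorem monotone_diam_inter_ball {X : Type*} [PseudoMetricSpace X] (K : Set X) (x : X) :
    Monotone fun r => Metric.diam (K ∩ Metric.ball x r) := fun _ _ hrs =>
  Metric.diam_mono (Set.inter_subset_inter_right _ (Metric.ball_subset_ball hrs))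
    (Metric.isBounded_ball.subset Set.inter_subset_right)

theorem convexDensity_nonneg {d : ℕ} (K : Set (EuclideanSpace ℝ (Fin d)))
    (x : EuclideanSpace ℝ (Fin d)) {r : ℝ} (hr : 0 < r) : 0 ≤ convexDensity K x r :=
  div_nonneg Metric.diam_nonneg (by positivity)

theorem convexDensity_le_one {d : ℕ} (K : Set (EuclideanSpace ℝ (Fin d)))
    (x : EuclideanSpace ℝ (Fin d)) {r : ℝ} (hr : 0 < r) : convexDensity K x r ≤ 1 := by
  rw [convexDensity_eq, div_le_one (by positivity)]
  exact (Metric.diam_mono Set.inter_subset_right Metric.isBounded_ball).trans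
    (Metric.diam_ball hr.le)

theorem intervalIntegrable_convexDensity_sq_div {d : ℕ} (K : Set (EuclideanSpace ℝ (Fin d)))
    (x : EuclideanSpace ℝ (Fin d)) {a b : ℝ} (ha : 0 < a) (hb : 0 < b) :
    IntervalIntegrable (fun t => convexDensity K x t ^ 2 / t) MeasureTheory.volume a b := by
  -- The integrand is this monotone function times the continuous `1 / (4 t^3)`.
  have hmono : Monotone fun r => Metric.diam (K ∩ Metric.ball x r) ^ 2 := fun r s hrs =>
    pow_le_pow_left₀ Metric.diam_nonneg (monotone_diam_inter_ball K x hrs) 2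
  have hcont : ContinuousOn (fun t : ℝ => (4 * t ^ 3)⁻¹) (Set.uIcc a b) := by
    refine ContinuousOn.inv₀ (by fun_prop) fun t ht => ?_
    have : 0 < t := (lt_min ha hb).trans_le ht.1
    positivity
  refine (hmono.intervalIntegrable.mul_continuousOn hcont).congr fun t ht => ?_
  have : 0 < t := (lt_min ha hb).trans ht.1
  simp only [convexDensity_eq]
  field_simp
  norm_num

theorem integral_convexDensity_sq_div_nonneg {d : ℕ} (K : Set (EuclideanSpace ℝ (Fin d)))
    (x : EuclideanSpace ℝ (Fin d)) {a b : ℝ} (ha : 0 < a) (hab : a ≤ b) :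
    0 ≤ ∫ t in a..b, convexDensity K x t ^ 2 / t :=
  intervalIntegral.integral_nonneg hab fun t ht => by
    have : 0 < t := ha.trans_le ht.1
    positivity

theorem integral_convexDensity_sq_div_le {d : ℕ} (K : Set (EuclideanSpace ℝ (Fin d)))
    (x : EuclideanSpace ℝ (Fin d)) {r : ℝ} (hr : 0 < r) (hr1 : r ≤ 1) :
    ∫ t in r..1, convexDensity K x t ^ 2 / t ≤ -Real.log r := by
  have h : ∫ t in r..1, t⁻¹ = -Real.log r := by
    rw [integral_inv_of_pos hr one_pos, one_div, Real.log_inv]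
  rw [← h]
  refine intervalIntegral.integral_mono_on hr1
    (intervalIntegrable_convexDensity_sq_div K x hr one_pos)
    (intervalIntegral.intervalIntegrable_inv (fun t ht => ?_) continuousOn_id) fun t ht => ?_
  · rw [Set.uIcc_of_le hr1] at ht
    exact (hr.trans_le ht.1).ne'
  · have ht0 : 0 < t := hr.trans_le ht.1
    rw [div_eq_mul_inv]
    exact mul_le_of_le_one_left (by positivity)
      (pow_le_one₀ (convexDensity_nonneg K x ht0) (convexDensity_le_one K x ht0))

theorem IsBranchingScale.le_integral {d : ℕ} {N : Set (EuclideanSpace ℝ (Fin d))}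
    {x : EuclideanSpace ℝ (Fin d)} (hx : x ∈ N) {k : ℕ} (hk : IsBranchingScale N x k) :
    1 ≤ 512 * ∫ t in (1 / 2 : ℝ) ^ (k + 1)..(1 / 2) ^ k, convexDensity N x t ^ 2 / t := by
  obtain ⟨y, hy, hle, hlt⟩ := hk
  set s : ℝ := (1 / 2) ^ k with hs
  have hs0 : 0 < s := by positivity
  rw [show (1 / 2 : ℝ) ^ (k + 3) = s / 8 by rw [hs]; ring] at hle
  rw [show (1 / 2 : ℝ) ^ (k + 1) = s / 2 by rw [hs]; ring] at hlt ⊢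
  have hab : s / 2 ≤ s := by linarith
  have hlow : ∫ _ in s / 2..s, (1 / (256 * s) : ℝ) ≤
      ∫ t in s / 2..s, convexDensity N x t ^ 2 / t := by
    refine intervalIntegral.integral_mono_on hab intervalIntegrable_const
      (intervalIntegrable_convexDensity_sq_div N x (by positivity) hs0) fun t ht => ?_
    have ht0 : 0 < t := lt_of_lt_of_le (by positivity) ht.1
    have hdiam : s / 8 ≤ Metric.diam (N ∩ Metric.ball x t) :=
      hle.trans (Metric.dist_le_diam_of_mem (Metric.isBounded_ball.subset Set.inter_subset_right)
        ⟨hx, Metric.mem_ball_self ht0⟩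
        ⟨hy, by rw [Metric.mem_ball, dist_comm]; exact hlt.trans_le ht.1⟩)
    -- The diameter is at least `s / 8` and `2 * t` is at most `2 * s`.
    have hdens : 1 / 16 ≤ convexDensity N x t := by
      rw [convexDensity_eq, le_div_iff₀ (by positivity)]
      linarith [ht.2]
    calc 1 / (256 * s) = (1 / 16) ^ 2 / s := by field_simp; norm_num
      _ ≤ convexDensity N x t ^ 2 / t := by
        gcongr
        exact ht.2
  rw [intervalIntegral.integral_const, smul_eq_mul,
    show (s - s / 2) * (1 / (256 * s)) = 1 / 512 by field_simp; norm_num] at hlow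
  linarith

theorem branchingCount_le_integral {d : ℕ} {N : Set (EuclideanSpace ℝ (Fin d))}
    {x : EuclideanSpace ℝ (Fin d)} (hx : x ∈ N) (n : ℕ) :
    (branchingCount N x 0 n : ℝ) ≤
      512 * ∫ t in (1 / 2 : ℝ) ^ n..1, convexDensity N x t ^ 2 / t := by
  classical
  induction n with
  | zero => simp [branchingCount]
  | succ n ih =>
    have hadd := intervalIntegral.integral_add_adjacent_intervals
      (intervalIntegrable_convexDensity_sq_div N x (a := (1 / 2 : ℝ) ^ (n + 1))
        (b := (1 / 2) ^ n) (by positivity) (by positivity))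
      (intervalIntegrable_convexDensity_sq_div N x (b := 1) (by positivity) one_pos)
    have hcount : branchingCount N x 0 (n + 1) =
        branchingCount N x 0 n + if IsBranchingScale N x n then 1 else 0 := by
      unfold branchingCount
      rw [← Finset.insert_Ico_right_eq_Ico_add_one (Nat.zero_le n), Finset.filter_insert]
      split_ifs
      · rw [Finset.card_insert_of_notMem (by simp)]
      · rfl
    rw [← hadd, hcount, mul_add]
    split_ifs with h
    · have := h.le_integral hx
      push_cast
      linarith
    · have := integral_convexDensity_sq_div_nonneg N x
        (show (0 : ℝ) < (1 / 2) ^ (n + 1) by positivity)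
        (pow_le_pow_of_le_one (by norm_num) (by norm_num) n.le_succ :
          (1 / 2 : ℝ) ^ (n + 1) ≤ (1 / 2) ^ n)
      push_cast
      linarith

theorem frequently_integral_lt_of_lowerMeanConvexDensitySq_lt {d : ℕ}
    {N : Set (EuclideanSpace ℝ (Fin d))} {x : EuclideanSpace ℝ (Fin d)} {β : ℝ}
    (h : lowerMeanConvexDensitySq N x < β) :
    ∃ᶠ r : ℝ in 𝓝[>] 0, ∫ t in r..1, convexDensity N x t ^ 2 / t < β * -Real.log r := by
  have hsmall : ∀ᶠ r : ℝ in 𝓝[>] 0, r ∈ Set.Ioo (0 : ℝ) 1 := Ioo_mem_nhdsGT one_pos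
  have hbdd : (𝓝[>] (0 : ℝ)).IsBoundedUnder (· ≤ ·)
      fun r : ℝ => (∫ t in r..1, convexDensity N x t ^ 2 / t) / (-Real.log r) :=
    isBoundedUnder_of_eventually_le (a := 1) <| hsmall.mono fun r hr =>
      div_le_one_of_le₀ (integral_convexDensity_sq_div_le N x hr.1 hr.2.le)
        (neg_nonneg.2 (Real.log_nonpos hr.1.le hr.2.le))
  refine ((frequently_lt_of_liminf_lt hbdd.isCoboundedUnder_ge h).and_eventually hsmall).mono ?_
  rintro r ⟨hlt, hr0, hr1⟩
  rwa [div_lt_iff₀ (neg_pos.2 (Real.log_neg hr0 hr1))] at hlt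

theorem frequently_branchingCount_le {d : ℕ} {N : Set (EuclideanSpace ℝ (Fin d))}
    {x : EuclideanSpace ℝ (Fin d)} (hx : x ∈ N) {β : ℝ} (hβ : 0 ≤ β)
    (h : lowerMeanConvexDensitySq N x < β) :
    ∃ᶠ n : ℕ in atTop, (branchingCount N x 0 n : ℝ) ≤ 1024 * β * n := by
  refine frequently_atTop.2 fun m => ?_
  -- The exponent `m + 1` forces `n > m`, hence `n ≥ 1` and `n + 1 ≤ 2 * n`; this factor 2 turns 512
  -- into 1024.
  have hsmall : ∀ᶠ r : ℝ in 𝓝[>] 0, r ∈ Set.Ioo (0 : ℝ) ((1 / 2) ^ (m + 1)) :=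
    Ioo_mem_nhdsGT (by positivity)
  obtain ⟨r, hr, hr0, hrm⟩ :=
    ((frequently_integral_lt_of_lowerMeanConvexDensitySq_lt h).and_eventually hsmall).exists
  have hr1 : r ≤ 1 := hrm.le.trans (pow_le_one₀ (by norm_num) (by norm_num))
  obtain ⟨n, hn1, hn2⟩ := exists_nat_pow_near_of_lt_one hr0 hr1
    (show (0 : ℝ) < 1 / 2 by norm_num) (by norm_num)
  have hmn : m + 1 < n + 1 := by
    by_contra! hle
    exact absurd (hn1.trans hrm) (not_lt.2 <|
      pow_le_pow_of_le_one (by norm_num) (by norm_num) hle)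
  refine ⟨n, by omega, (branchingCount_le_integral hx n).trans ?_⟩
  have hlog : -Real.log r ≤ n + 1 := by
    have h1 := Real.log_le_log (by positivity) hn1.le
    have h2 : Real.log 2 ≤ 1 := Real.log_two_lt_d9.le.trans (by norm_num)
    rw [Real.log_pow, one_div, Real.log_inv] at h1
    push_cast at h1
    nlinarith
  have hadd := intervalIntegral.integral_add_adjacent_intervals
    (intervalIntegrable_convexDensity_sq_div N x (b := (1 / 2 : ℝ) ^ n) hr0 (by positivity))
    (intervalIntegrable_convexDensity_sq_div N x (b := 1) (by positivity) one_pos)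
  have hnn := integral_convexDensity_sq_div_nonneg N x hr0 hn2
  have hn : (1 : ℝ) ≤ n := by exact_mod_cast (by omega : 1 ≤ n)
  have hmul : β * -Real.log r ≤ β * (2 * n) := by gcongr; linarith
  linarith

theorem theorem7 (d : ℕ) (hd : 1 ≤ d) :
    ∃ c : ℝ, 0 < c ∧
      ∀ (N : Set (EuclideanSpace ℝ (Fin d))) (d₀ : ℝ),
        (∀ x ∈ N, lowerMeanConvexDensitySq N x ≤ d₀ ^ 2) →
          dimH N ≤ ENNReal.ofReal (c * d₀ ^ 2) := by
  obtain ⟨M, hM⟩ := exists_isHalvingConstant (EuclideanSpace ℝ (Fin d))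
  have hD : IsHalvingConstant (EuclideanSpace ℝ (Fin d)) (2 ^ (M + 1)) := fun r E hr hE => by
    obtain ⟨F, hF, h⟩ := hM r E hr hE
    exact ⟨F, hF.trans (M.le_succ.trans Nat.lt_two_pow_self.le), h⟩
  refine ⟨((M + 1 : ℕ) : ℝ) * 1024, by positivity, fun N d₀ hN => ?_⟩
  -- Only a strict bound on the liminf yields infinitely many good scales, hence the limit in `β` at
  -- the end.
  have hbound : ∀ β > d₀ ^ 2, dimH N ≤ ENNReal.ofReal (((M + 1 : ℕ) : ℝ) * 1024 * β) := by
    intro β hβ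
    have hβ0 : 0 ≤ β := (sq_nonneg d₀).trans hβ.le
    rw [mul_assoc]
    exact dimH_le_of_frequently_branchingCount_le hD (by positivity)
      fun x hx => frequently_branchingCount_le hx hβ0 ((hN x hx).trans_lt hβ)
  have hcont : Tendsto (fun β : ℝ => ENNReal.ofReal (((M + 1 : ℕ) : ℝ) * 1024 * β))
      (𝓝[>] (d₀ ^ 2)) (𝓝 (ENNReal.ofReal (((M + 1 : ℕ) : ℝ) * 1024 * d₀ ^ 2))) :=
    ENNReal.tendsto_ofReal
      ((continuous_const.mul continuous_id).tendsto (d₀ ^ 2) |>.mono_left nhdsWithin_le_nhds)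
  exact ge_of_tendsto hcont (eventually_mem_nhdsWithin.mono hbound)
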